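/- Let $R$ be a commutative noetherian ring, $\mathfrak a$ an ideal of $R$, $M$ an $R$-module and $n\ge 0$ an integer. For an $R$-module $X$ let $\Gamma_{\mathfrak a}(X)=\bigcup_{k}(0:_X\mathfrak a^k)$, and let $H^i_{\mathfrak a}$ be the $i$-th right derived functor of $\Gamma_{\mathfrak a}$. For an injective resolution $I^\bullet$ of $M$ one has $\operatorname{Ext}^n_R(R/\mathfrak a,M)=H^n(\operatorname{Hom}_R(R/\mathfrak a,I^\bullet))=H^n(\operatorname{Hom}_R(R/\mathfrak a,\Gamma_{\mathfrak a}(I^\bullet)))$ and $H^n_{\mathfrak a}(M)=H^n(\Gamma_{\mathfrak a}(I^\bullet))$. Let $$f:\operatorname{Ext}^n_R(R/\mathfrak a,M)\longrightarrow \operatorname{Hom}_R(R/\mathfrak a,H^n_{\mathfrak a}(M))$$ be the natural homomorphism, which sends the class of a cocycle $\varphi:R/\mathfrak a\to I^n$ to the homomorphism $x\mapsto[\varphi(x)]$. Let $\mathcal S$ be a Serre subcategory of the category of $R$-modules, i.e. a class of $R$-modules containing $0$ and closed under submodules, quotients and extensions (and hence under isomorphisms). (a) If $\operatorname{Ext}^{n-j}_R(R/\mathfrak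 a,H^j_{\mathfrak a}(M))\in\mathcal S$ for all $0\le j<n$, then $\operatorname{Ker} f\in\mathcal S$. In particular, if these Ext modules are finitely generated for all $0\le j<n$, then $\operatorname{Ker} f$ is finitely generated. (b) If $\operatorname{Ext}^{n+1-j}_R(R/\mathfrak a,H^j_{\mathfrak a}(M))\in\mathcal S$ for all $0\le j<n$, then $\operatorname{Coker} f\in\mathcal S$. In particular, if these Ext modules are finitely generated for all $0\le j<n$, then $\operatorname{Coker} f$ is finitely generated. (c) If $\operatorname{Ext}^{t-j}_R(R/\mathfrak a,H^j_{\mathfrak a}(M))\in\mathcal S$ for $t=n,n+1$ and all $0\le j<n$, then $\operatorname{Ker} f$ and $\operatorname{Coker} f$ both belong to $\mathcal S$; thus $\operatorname{Ext}^n_R(R/\mathfrak a,M)\in\mathcal S$ if and only if $\operatorname{Hom}_R(R/\mathfrak a,H^n_{\mathfrak a}(M))\in\mathcal S$. In particular, if $\operatorname{Ext}^{t-j}_R(R/\mathfrak a,H^j_{\mathfrak a}(M))$ is finitely generated for $t=n,n+1$ and all $0\le j<n$, then $\operatorname{Ker} f$ and $\operatorname{Coker} f$ are finitely generated, and $\operatorname{Ext}^n_R(R/\mathfrak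 a,M)$ is finitely generated if and only if $\operatorname{Hom}_R(R/\mathfrak a,H^n_{\mathfrak a}(M))$ is finitely generated. -/

import Mathlib

open CategoryTheory

universe u

noncomputable section

namespace LocalCohomologyViaTorsion

variable {R : Type u} [CommRing R]

/-- The `𝔞`-torsion submodule `Γ_𝔞(M) = ⋃ₖ (0 :_M 𝔞ᵏ)`: the elements of `M` which are annihilated
by some power of the ideal `𝔞`. -/
def torsionPart (𝔞 : Ideal R) (M : Type u) [AddCommGroup M] [Module R M] : Submodule R M where
  carrier := {m | ∃ k : ℕ, ∀ r ∈ 𝔞 ^ k, r • m = 0}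
  zero_mem' := ⟨0, fun r _ => smul_zero r⟩
  add_mem' := by
    rintro x y ⟨k, hk⟩ ⟨l, hl⟩
    refine ⟨max k l, fun r hr => ?_⟩
    rw [smul_add, hk r (Ideal.pow_le_pow_right (le_max_left k l) hr),
      hl r (Ideal.pow_le_pow_right (le_max_right k l) hr), add_zero]
  smul_mem' := by
    rintro c x ⟨k, hk⟩
    exact ⟨k, fun r hr => by rw [smul_comm, hk r hr, smul_zero]⟩

/-- A linear map sends `Γ_𝔞(M)` into `Γ_𝔞(N)`. -/
theorem map_mem_torsionPart (𝔞 : Ideal R) {M N : Type u} [AddCommGroup M] [Module R M]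
    [AddCommGroup N] [Module R N] (g : M →ₗ[R] N) {m : M} (hm : m ∈ torsionPart 𝔞 M) :
    g m ∈ torsionPart 𝔞 N := by
  obtain ⟨k, hk⟩ := hm
  exact ⟨k, fun r hr => by rw [← map_smul, hk r hr, map_zero]⟩

/-- The `𝔞`-torsion functor `Γ_𝔞` on the category of `R`-modules. On morphisms it is restriction. -/
def torsionFunctor (𝔞 : Ideal R) : ModuleCat.{u} R ⥤ ModuleCat.{u} R where
  obj M := ModuleCat.of R (torsionPart 𝔞 M)
  map g := ModuleCat.ofHom (g.hom.restrict fun _ hm => map_mem_torsionPart 𝔞 g.hom hm)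
  map_id _ := rfl
  map_comp _ _ := rfl

instance (𝔞 : Ideal R) : (torsionFunctor 𝔞).Additive where
  map_add := rfl

/-- The inclusion `Γ_𝔞(M) ⟶ M`. -/
def torsionIncl (𝔞 : Ideal R) (M : ModuleCat.{u} R) : (torsionFunctor 𝔞).obj M ⟶ M :=
  ModuleCat.ofHom (torsionPart 𝔞 M).subtype

/-- The `n`-th local cohomology module `H^n_𝔞(M)`, where `H^n_𝔞` is the `n`-th right derived
functor of the `𝔞`-torsion functor. -/
abbrev localCoh (𝔞 : Ideal R) (n : ℕ) (M : ModuleCat.{u} R) : ModuleCat.{u} R :=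
  ((torsionFunctor 𝔞).rightDerived n).obj M

/-- The cyclic module `R/𝔞`. -/
abbrev cyc (𝔞 : Ideal R) : ModuleCat.{u} R := ModuleCat.of R (R ⧸ 𝔞)

/-- The `R`-module `Ext^n_R(R/𝔞, M)`. -/
abbrev extCyc (𝔞 : Ideal R) (n : ℕ) (M : ModuleCat.{u} R) : ModuleCat.{u} R :=
  ModuleCat.of R (Abelian.Ext (cyc 𝔞) M n)

/-- The `R`-module `Hom_R(R/𝔞, M)`. -/
abbrev homCyc (𝔞 : Ideal R) (M : ModuleCat.{u} R) : ModuleCat.{u} R :=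
  ModuleCat.of R (cyc 𝔞 ⟶ M)

/-- Every homomorphism `R/𝔞 ⟶ M` takes values in `Γ_𝔞(M)`; this is the same homomorphism with
restricted codomain. -/
def toTorsion (𝔞 : Ideal R) {M : ModuleCat.{u} R} (φ : cyc 𝔞 ⟶ M) :
    cyc 𝔞 ⟶ (torsionFunctor 𝔞).obj M :=
  ModuleCat.ofHom (φ.hom.codRestrict (torsionPart 𝔞 M) fun x => ⟨1, fun r hr => by
    obtain ⟨y, rfl⟩ := Ideal.Quotient.mk_surjective x
    rw [pow_one] at hr
    rw [← map_smul, Algebra.smul_def, Ideal.Quotient.algebraMap_eq,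
      Ideal.Quotient.eq_zero_iff_mem.2 hr, zero_mul, map_zero]⟩)

theorem toTorsion_map (𝔞 : Ideal R) {M N : ModuleCat.{u} R} (φ : cyc 𝔞 ⟶ M) (g : M ⟶ N) :
    toTorsion 𝔞 φ ≫ (torsionFunctor 𝔞).map g = toTorsion 𝔞 (φ ≫ g) := rfl

section NaturalMap

variable (𝔞 : Ideal R) {M : ModuleCat.{u} R} (I : InjectiveResolution M) (n : ℕ)

/-- The complex `Γ_𝔞(I)` for an injective resolution `I`. -/
abbrev torsionComplex : CochainComplex (ModuleCat.{u} R) ℕ :=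
  ((torsionFunctor 𝔞).mapHomologicalComplex (ComplexShape.up ℕ)).obj I.cocomplex

/-- The isomorphism `H^n(Γ_𝔞(I)) ≅ H^n_𝔞(M)`. -/
def localCohIso : (torsionComplex 𝔞 I).homology n ≅ localCoh 𝔞 n M :=
  (I.isoRightDerivedObj (torsionFunctor 𝔞) n).symm

/-- The cocycles of degree `n` of the complex `Hom_R(R/𝔞, I)`. -/
def cocycles : Submodule R (cyc 𝔞 ⟶ I.cocomplex.X n) where
  carrier := {φ | φ ≫ I.cocomplex.d n (n + 1) = 0}
  zero_mem' := Limits.zero_comp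
  add_mem' := by
    intro φ ψ hφ hψ
    rw [Set.mem_ofPred_eq] at *
    rw [Preadditive.add_comp, hφ, hψ, add_zero]
  smul_mem' := by
    intro r φ hφ
    rw [Set.mem_ofPred_eq] at *
    rw [Linear.smul_comp, hφ, smul_zero]

variable {n} in
theorem mem_cocycles {φ : cyc 𝔞 ⟶ I.cocomplex.X n} (hφ : φ ∈ cocycles 𝔞 I n) :
    φ ≫ I.cocomplex.d n (n + 1) = 0 := hφ

/-- The surjection from the cocycles of degree `n` of `Hom_R(R/𝔞, I)` onto `Ext^n_R(R/𝔞, M)`. -/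
def cocyclesToExt : cocycles 𝔞 I n →ₗ[R] Abelian.Ext (cyc 𝔞) M n where
  toFun φ := I.extMk φ.1 (n + 1) rfl (mem_cocycles 𝔞 I φ.2)
  map_add' φ ψ := (I.add_extMk φ.1 ψ.1 (n + 1) rfl (mem_cocycles 𝔞 I φ.2)
    (mem_cocycles 𝔞 I ψ.2)).symm
  map_smul' r φ := by
    have h := I.mk₀_comp_extMk φ.1 (n + 1) rfl (mem_cocycles 𝔞 I φ.2) (r • 𝟙 (cyc 𝔞))
    rw [Abelian.Ext.mk₀_smul, Abelian.Ext.smul_comp, Abelian.Ext.mk₀_id_comp] at h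
    refine Eq.trans ?_ h.symm
    congr 1
    rw [Linear.smul_comp, Category.id_comp]
    rfl

theorem cocyclesToExt_surjective : Function.Surjective (cocyclesToExt 𝔞 I n) := fun α => by
  obtain ⟨φ, hφ, h⟩ := I.extMk_surjective α (n + 1) rfl
  exact ⟨⟨φ, hφ⟩, h⟩

variable {n} in
/-- A cocycle `φ` of `Hom_R(R/𝔞, I)`, seen as a homomorphism from `R/𝔞` to the module of cocycles
of `Γ_𝔞(I)`. -/
def toTorsionCycles (φ : cyc 𝔞 ⟶ I.cocomplex.X n) (hφ : φ ≫ I.cocomplex.d n (n + 1) = 0) :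
    cyc 𝔞 ⟶ (torsionComplex 𝔞 I).cycles n :=
  (torsionComplex 𝔞 I).liftCycles (k := toTorsion 𝔞 φ) (n + 1) (CochainComplex.next ℕ n) (by
    refine (toTorsion_map 𝔞 φ (I.cocomplex.d n (n + 1))).trans ?_
    rw [hφ]
    rfl)

variable {n} in
theorem toTorsionCycles_i (φ : cyc 𝔞 ⟶ I.cocomplex.X n)
    (hφ : φ ≫ I.cocomplex.d n (n + 1) = 0) :
    toTorsionCycles 𝔞 I φ hφ ≫ (torsionComplex 𝔞 I).iCycles n = toTorsion 𝔞 φ :=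
  HomologicalComplex.liftCycles_i _ _ _ _ _

/-- The map sending a cocycle `φ : R/𝔞 ⟶ Iⁿ` of `Hom_R(R/𝔞, I)` to the homomorphism
`R/𝔞 ⟶ H^n_𝔞(M)` whose value at `x` is the class of the cocycle `φ x` of `Γ_𝔞(I)`. -/
def cocyclesToHom : cocycles 𝔞 I n →ₗ[R] (cyc 𝔞 ⟶ localCoh 𝔞 n M) where
  toFun φ := toTorsionCycles 𝔞 I φ.1 (mem_cocycles 𝔞 I φ.2) ≫
    (torsionComplex 𝔞 I).homologyπ n ≫ (localCohIso 𝔞 I n).hom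
  map_add' φ ψ := by
    rw [← Preadditive.add_comp]
    congr 1
    rw [← cancel_mono ((torsionComplex 𝔞 I).iCycles n), Preadditive.add_comp,
      toTorsionCycles_i, toTorsionCycles_i, toTorsionCycles_i]
    rfl
  map_smul' r φ := by
    rw [RingHom.id_apply, ← Linear.smul_comp]
    congr 1
    rw [← cancel_mono ((torsionComplex 𝔞 I).iCycles n), Linear.smul_comp,
      toTorsionCycles_i, toTorsionCycles_i]
    rfl

/-- A cocycle whose class in `Ext^n_R(R/𝔞, M)` vanishes induces the zero map to `H^n_𝔞(M)`. -/
theorem ker_cocyclesToExt_le :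
    LinearMap.ker (cocyclesToExt 𝔞 I n) ≤ LinearMap.ker (cocyclesToHom 𝔞 I n) := by
  rintro ⟨φ, hφ⟩ h
  rw [LinearMap.mem_ker] at h ⊢
  replace hφ : φ ≫ I.cocomplex.d n (n + 1) = 0 := hφ
  replace h : I.extMk φ (n + 1) rfl hφ = 0 := h
  rcases n with _ | p
  · have hz : φ = 0 := by
      rw [← I.extEquivCohomologyClass.apply_eq_iff_eq,
        InjectiveResolution.extEquivCohomologyClass_extMk,
        InjectiveResolution.extEquivCohomologyClass_zero,
        CochainComplex.HomComplex.CohomologyClass.mk_eq_zero_iff,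
        CochainComplex.HomComplex.Cocycle.fromSingleMk_mem_coboundaries_iff _ _ _ _ _ (-1)
          (by simp)] at h
      obtain ⟨g, hg⟩ := h
      have hzero : Limits.IsZero (I.cochainComplex.X (-1)) :=
        I.cochainComplex.isZero_of_isStrictlyGE 0 (-1) (by simp)
      rw [hzero.eq_of_tgt g 0, Limits.zero_comp] at hg
      rw [← cancel_mono (I.cochainComplexXIso (0 : ℕ) 0 rfl).inv, ← hg, Limits.zero_comp]
    subst hz
    exact map_zero (cocyclesToHom 𝔞 I 0)
  · obtain ⟨g, rfl⟩ := (I.extMk_eq_zero_iff φ (p + 1 + 1) rfl hφ p rfl).1 h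
    have hb : toTorsionCycles 𝔞 I (g ≫ I.cocomplex.d p (p + 1)) hφ ≫
        (torsionComplex 𝔞 I).homologyπ (p + 1) = 0 :=
      (torsionComplex 𝔞 I).liftCycles_homologyπ_eq_zero_of_boundary _ _ _
        (toTorsion 𝔞 g) (toTorsion_map 𝔞 g _).symm
    exact (Category.assoc _ _ _).symm.trans
      ((congrArg (fun ψ => ψ ≫ (localCohIso 𝔞 I (p + 1)).hom) hb).trans Limits.zero_comp)

/-- The natural homomorphism `Ext^n_R(R/𝔞, M) → Hom_R(R/𝔞, H^n_𝔞(M))` computed with the injective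
resolution `I` of `M`: under `Ext^n_R(R/𝔞, M) = H^n(Hom_R(R/𝔞, I)) = H^n(Hom_R(R/𝔞, Γ_𝔞(I)))` and
`H^n_𝔞(M) = H^n(Γ_𝔞(I))`, it sends the class of a cocycle `φ` to the homomorphism which sends `x`
to the class of `φ x`. -/
def naturalMapOf : Abelian.Ext (cyc 𝔞) M n →ₗ[R] (cyc 𝔞 ⟶ localCoh 𝔞 n M) :=
  (LinearMap.ker (cocyclesToExt 𝔞 I n)).liftQ (cocyclesToHom 𝔞 I n)
      (ker_cocyclesToExt_le 𝔞 I n) ∘ₗ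
    ((cocyclesToExt 𝔞 I n).quotKerEquivOfSurjective (cocyclesToExt_surjective 𝔞 I n)).symm

theorem naturalMapOf_cocyclesToExt (φ : cocycles 𝔞 I n) :
    naturalMapOf 𝔞 I n (cocyclesToExt 𝔞 I n φ) = cocyclesToHom 𝔞 I n φ := by
  have h : ((cocyclesToExt 𝔞 I n).quotKerEquivOfSurjective
      (cocyclesToExt_surjective 𝔞 I n)).symm (cocyclesToExt 𝔞 I n φ) =
      Submodule.Quotient.mk φ := by
    rw [LinearEquiv.symm_apply_eq]
    rfl
  rw [naturalMapOf, LinearMap.comp_apply, LinearEquiv.coe_coe, h]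
  rfl

end NaturalMap

/-- The natural homomorphism `f : Ext^n_R(R/𝔞, M) → Hom_R(R/𝔞, H^n_𝔞(M))`. -/
def naturalMap (𝔞 : Ideal R) (M : ModuleCat.{u} R) (n : ℕ) :
    extCyc 𝔞 n M →ₗ[R] homCyc 𝔞 (localCoh 𝔞 n M) :=
  naturalMapOf 𝔞 (injectiveResolution M) n

/-- The kernel of the natural homomorphism. -/
abbrev kerNaturalMap (𝔞 : Ideal R) (M : ModuleCat.{u} R) (n : ℕ) : ModuleCat.{u} R :=
  ModuleCat.of R (LinearMap.ker (naturalMap 𝔞 M n))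

/-- The cokernel of the natural homomorphism. -/
abbrev cokerNaturalMap (𝔞 : Ideal R) (M : ModuleCat.{u} R) (n : ℕ) : ModuleCat.{u} R :=
  ModuleCat.of R (homCyc 𝔞 (localCoh 𝔞 n M) ⧸ LinearMap.range (naturalMap 𝔞 M n))

end LocalCohomologyViaTorsion

end

/-! Put `A = R/𝔞` and `K = Γ_𝔞(I)`, so that `Hʲ(K) ≅ Hʲ_𝔞(M)`. By Artin–Rees `K` again consists of
injectives, and `Hom(A, I) = Hom(A, K)`, so the n-cocycles of `Hom(A, I)` are the maps `A → Zⁿ`. No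
spectral sequence is needed, only `0 → Bⁿ → Zⁿ → Hⁿ → 0` and `0 → Zⁿ → Kⁿ → Bⁿ⁺¹ → 0`.

The image of `f` is that of `Hom(A, Zⁿ)` in `Hom(A, Hⁿ)`, so `Coker f` embeds in `Ext¹(A, Bⁿ)`
(`ker_homToExtBoundaries_le`). The kernel of `f` is `Hom(A, Bⁿ)` modulo `Hom(A, Kⁿ⁻¹)`, so it embeds
in `Ext¹(A, Zⁿ⁻¹)` (`ker_kerToExtCycles_le`).

Both targets lie in the Serre class by `prop_ext_boundaries`: injectivity of `Kᵏ` embeds `Extⁱ(A,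
Bᵏ⁺¹)` in `Extⁱ⁺¹(A, Zᵏ)` for `i > 0`, and the latter sits between `Extⁱ⁺¹(A, Bᵏ)` and `Extⁱ⁺¹(A,
Hᵏ)`; induct down to `B⁰ = 0`. -/

/-! ### Torsion preserves injectives. -/

section Torsion

namespace LocalCohomologyViaTorsion

variable {R : Type u} [CommRing R]

/-- A finitely generated submodule of `Γ_𝔞(M)` is annihilated by a single power of `𝔞`. -/
theorem exists_pow_smul_eq_zero_of_fg (𝔞 : Ideal R) {M : Type u} [AddCommGroup M] [Module R M]
    (N : Submodule R M) (hN : N.FG) (h : N ≤ torsionPart 𝔞 M) :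
    ∃ k : ℕ, ∀ r ∈ 𝔞 ^ k, ∀ x ∈ N, r • x = 0 := by
  induction N, hN using Submodule.fg_induction with
  | singleton x =>
    obtain ⟨k, hk⟩ := h (Submodule.mem_span_singleton_self x)
    refine ⟨k, fun r hr y hy => ?_⟩
    obtain ⟨c, rfl⟩ := Submodule.mem_span_singleton.1 hy
    rw [smul_comm, hk r hr, smul_zero]
  | sup N₁ N₂ _ _ h₁ h₂ =>
    obtain ⟨k, hk⟩ := h₁ (le_sup_left.trans h)
    obtain ⟨l, hl⟩ := h₂ (le_sup_right.trans h)
    refine ⟨max k l, fun r hr y hy => ?_⟩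
    obtain ⟨y₁, hy₁, y₂, hy₂, rfl⟩ := Submodule.mem_sup.1 hy
    rw [smul_add, hk r (Ideal.pow_le_pow_right (le_max_left k l) hr) y₁ hy₁,
      hl r (Ideal.pow_le_pow_right (le_max_right k l) hr) y₂ hy₂, add_zero]

/-- Over a noetherian ring, `Γ_𝔞` preserves injective modules. -/
theorem injective_torsionPart [IsNoetherianRing R] (𝔞 : Ideal R) (E : Type u) [AddCommGroup E]
    [Module R E] [Module.Injective R E] : Module.Injective R (torsionPart 𝔞 E) := by
  refine Module.Baer.injective fun 𝔟 g => ?_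
  let φ : 𝔟 →ₗ[R] E := (torsionPart 𝔞 E).subtype ∘ₗ g
  obtain ⟨k, hk⟩ := exists_pow_smul_eq_zero_of_fg 𝔞 (LinearMap.range φ)
    (Module.Finite.iff_fg.1 inferInstance) (by
      rintro _ ⟨x, rfl⟩
      exact (g x).2)
  -- Artin–Rees gives `𝔞^(l+k) ∩ 𝔟 ⊆ 𝔞^k 𝔟`, which `φ` kills; hence `φ` factors through the image of
  -- `𝔟` in `R/𝔞^(l+k)`.
  obtain ⟨l, hl⟩ := 𝔞.exists_pow_inf_eq_pow_smul (M := R) 𝔟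
  let L : 𝔟 →ₗ[R] R ⧸ 𝔞 ^ (l + k) := (𝔞 ^ (l + k)).mkQ ∘ₗ 𝔟.subtype
  have hL : LinearMap.ker L ≤ LinearMap.ker φ := by
    intro x hx
    have hx' : (x : R) ∈ 𝔞 ^ (l + k) :=
      (Submodule.Quotient.mk_eq_zero _).1 (LinearMap.mem_ker.1 hx)
    have hmem : (x : R) ∈ 𝔞 ^ k • 𝔟 := by
      have hx2 : (x : R) ∈ 𝔞 ^ (l + k) • (⊤ : Submodule R R) ⊓ 𝔟 :=
        ⟨by simpa using hx', x.2⟩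
      rw [hl (l + k) (Nat.le_add_right l k), Nat.add_sub_cancel_left] at hx2
      exact Submodule.smul_mono le_rfl inf_le_right hx2
    have key : 𝔞 ^ k • 𝔟 ≤ (LinearMap.ker φ).map 𝔟.subtype := by
      refine Submodule.smul_le.2 fun r hr y hy => ⟨r • ⟨y, hy⟩, ?_, rfl⟩
      change φ (r • ⟨y, hy⟩) = 0
      rw [map_smul]
      exact hk r hr _ ⟨_, rfl⟩
    obtain ⟨z, hz, hzx⟩ := key hmem
    rwa [← Subtype.ext hzx]
  obtain ⟨ψ, hψ⟩ := Module.Injective.out ((LinearMap.ker L).liftQ L le_rfl)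
    (LinearMap.ker_eq_bot.1 (Submodule.ker_liftQ_eq_bot _ _ _ le_rfl))
    ((LinearMap.ker L).liftQ φ hL)
  -- The extension `ψ` starts from `R/𝔞^(l+k)`, so its values are torsion.
  refine ⟨(ψ ∘ₗ (𝔞 ^ (l + k)).mkQ).codRestrict (torsionPart 𝔞 E)
    fun c => ⟨l + k, fun r hr => ?_⟩, fun x hx => Subtype.ext ?_⟩
  · have h : (𝔞 ^ (l + k)).mkQ (r • c) = 0 :=
      (Submodule.Quotient.mk_eq_zero _).2 (Ideal.mul_mem_right c _ hr)
    rw [← map_smul, LinearMap.comp_apply, h, map_zero]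
  · exact hψ (Submodule.Quotient.mk ⟨x, hx⟩)

instance [IsNoetherianRing R] (𝔞 : Ideal R) (E : ModuleCat.{u} R) [Injective E] :
    Injective ((torsionFunctor 𝔞).obj E) := by
  have : Module.Injective R E := (Module.injective_iff_injective_object R E).2 inferInstance
  have := injective_torsionPart 𝔞 E
  exact Module.injective_object_of_injective_module R (torsionPart 𝔞 E)

end LocalCohomologyViaTorsion

end Torsion

/-! ### Serre classes of modules. -/

section SerreClass

variable {R : Type u} [CommRing R] (S : ObjectProperty (ModuleCat.{u} R)) [S.IsSerreClass]

theorem CategoryTheory.ObjectProperty.prop_of_linearMap_injective {X Y : Type u} [AddCommGroup X]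
    [Module R X] [AddCommGroup Y] [Module R Y] (f : X →ₗ[R] Y) (hf : Function.Injective f)
    (hY : S (ModuleCat.of R Y)) : S (ModuleCat.of R X) :=
  have : Mono (ModuleCat.ofHom f) := (ModuleCat.mono_iff_injective _).2 hf
  S.prop_of_mono (ModuleCat.ofHom f) hY

theorem CategoryTheory.ObjectProperty.prop_of_linearMap_surjective {X Y : Type u} [AddCommGroup X]
    [Module R X] [AddCommGroup Y] [Module R Y] (f : X →ₗ[R] Y) (hf : Function.Surjective f)
    (hX : S (ModuleCat.of R X)) : S (ModuleCat.of R Y) :=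
  have : Epi (ModuleCat.ofHom f) := (ModuleCat.epi_iff_surjective _).2 hf
  S.prop_of_epi (ModuleCat.ofHom f) hX

theorem CategoryTheory.ObjectProperty.prop_of_function_exact {X Y Z : Type u} [AddCommGroup X]
    [Module R X] [AddCommGroup Y] [Module R Y] [AddCommGroup Z] [Module R Z] (f : X →ₗ[R] Y)
    (g : Y →ₗ[R] Z) (h : Function.Exact f g) (hX : S (ModuleCat.of R X))
    (hZ : S (ModuleCat.of R Z)) : S (ModuleCat.of R Y) := by
  refine S.prop_X₂_of_exact (S := ShortComplex.mk (ModuleCat.ofHom f) (ModuleCat.ofHom g)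
    (by ext x; exact h.apply_apply_eq_zero x)) ?_ hX hZ
  rw [ShortComplex.ShortExact.moduleCat_exact_iff_function_exact]
  exact h

/-- If `p : X → Y` is surjective and `g : X → Z` satisfies `ker g ≤ ker p`, then `Y` is a
subquotient of `Z`, so it belongs to every Serre class containing `Z`. -/
theorem CategoryTheory.ObjectProperty.prop_of_ker_le_ker {X Y Z : Type u} [AddCommGroup X]
    [Module R X] [AddCommGroup Y] [Module R Y] [AddCommGroup Z] [Module R Z] (p : X →ₗ[R] Y)
    (hp : Function.Surjective p) (g : X →ₗ[R] Z) (hg : LinearMap.ker g ≤ LinearMap.ker p)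
    (hZ : S (ModuleCat.of R Z)) : S (ModuleCat.of R Y) := by
  have h : S (ModuleCat.of R (X ⧸ LinearMap.ker g)) :=
    S.prop_of_linearMap_injective ((LinearMap.ker g).liftQ g le_rfl)
      (LinearMap.ker_eq_bot.1 (Submodule.ker_liftQ_eq_bot _ _ _ le_rfl)) hZ
  exact S.prop_of_linearMap_surjective ((LinearMap.ker g).liftQ p hg)
    (fun y => by
      obtain ⟨x, rfl⟩ := hp y
      exact ⟨Submodule.Quotient.mk x, rfl⟩) h

/-- The finitely generated modules over a noetherian ring form a Serre class. -/
theorem ModuleCat.isSerreClass_finite [IsNoetherianRing R] :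
    ObjectProperty.IsSerreClass (fun X : ModuleCat.{u} R => Module.Finite R X) where
  exists_zero := ⟨ModuleCat.of R PUnit.{u + 1}, ModuleCat.isZero_of_subsingleton _,
    inferInstanceAs (Module.Finite R PUnit.{u + 1})⟩
  prop_of_mono f _ _ :=
    Module.Finite.of_injective f.hom ((ModuleCat.mono_iff_injective f).1 inferInstance)
  prop_of_epi f _ _ :=
    Module.Finite.of_surjective f.hom ((ModuleCat.epi_iff_surjective f).1 inferInstance)
  prop_X₂_of_shortExact {T} hT h₁ h₃ := by
    have := h₁
    have := h₃
    have hex := (ShortComplex.ShortExact.moduleCat_exact_iff_function_exact T).1 hT.exact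
    exact Module.Finite.of_exact hex ((ModuleCat.epi_iff_surjective T.g).1 hT.epi_g)

end SerreClass

/-! ### Boundaries and cycles of a cochain complex. -/

section BoundariesCycles

namespace HomologicalComplex

variable {C : Type*} [Category* C] [Abelian C] (K : CochainComplex C ℕ)

/-- The boundaries of degree `n`, as the kernel of the projection of the cycles to homology. -/
noncomputable abbrev boundaries (n : ℕ) : C := Limits.kernel (K.homologyπ n)

/-- The differential as a map to the boundaries. -/
noncomputable abbrev toBoundaries (n : ℕ) : K.X n ⟶ boundaries K (n + 1) :=
  Limits.kernel.lift (K.homologyπ (n + 1)) (K.toCycles n (n + 1))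
    (K.toCycles_comp_homologyπ n (n + 1))

theorem toBoundaries_ι_iCycles (n : ℕ) :
    toBoundaries K n ≫ Limits.kernel.ι _ ≫ K.iCycles (n + 1) = K.d n (n + 1) := by
  simp

/-- The short complex `Bⁿ → Zⁿ → Hⁿ`. -/
noncomputable abbrev boundariesCyclesHomology (n : ℕ) : ShortComplex C :=
  ShortComplex.mk (Limits.kernel.ι (K.homologyπ n)) (K.homologyπ n)
    (Limits.kernel.condition _)

theorem shortExact_boundariesCyclesHomology (n : ℕ) :
    (boundariesCyclesHomology K n).ShortExact where
  exact := ShortComplex.exact_of_f_is_kernel _ (Limits.kernelIsKernel _)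

/-- The short complex `Zⁿ → Kⁿ → Bⁿ⁺¹`. -/
noncomputable abbrev cyclesBoundaries (n : ℕ) : ShortComplex C :=
  ShortComplex.mk (K.iCycles n) (toBoundaries K n) (by
    rw [← cancel_mono (Limits.kernel.ι (K.homologyπ (n + 1)) ≫ K.iCycles (n + 1)),
      Category.assoc, toBoundaries_ι_iCycles]
    simp)

/-- Homology is the cokernel of `Kⁿ → Zⁿ⁺¹`, so the kernel of the projection to it is the image of
that map. -/
theorem epi_toBoundaries (n : ℕ) : Epi (toBoundaries K n) := by
  have h : (ShortComplex.mk _ _ (K.toCycles_comp_homologyπ n (n + 1))).Exact :=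
    ShortComplex.exact_of_g_is_cokernel _ (K.homologyIsCokernel n (n + 1) (by simp))
  exact h.epi_kernelLift

/-- Since `Bⁿ⁺¹` embeds in `Kⁿ⁺¹`, the map to boundaries has the same kernel as the differential. -/
theorem shortExact_cyclesBoundaries (n : ℕ) : (cyclesBoundaries K n).ShortExact where
  epi_g := epi_toBoundaries K n
  exact := by
    have h : (ShortComplex.mk _ _ (K.iCycles_d n (n + 1))).Exact :=
      ShortComplex.exact_of_f_is_kernel _ (K.cyclesIsKernel n (n + 1) (by simp))
    rw [ShortComplex.exact_iff_exact_up_to_refinements] at h ⊢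
    intro A x hx
    have hx' : x ≫ toBoundaries K n = 0 := hx
    exact h x (by
      change x ≫ K.d n (n + 1) = 0
      rw [← toBoundaries_ι_iCycles, reassoc_of% hx', Limits.zero_comp])

theorem isZero_boundaries_zero : Limits.IsZero (boundaries K 0) := by
  have h : K.toCycles (0 - 1) 0 = 0 := by
    rw [← cancel_mono (K.iCycles 0), toCycles_i, K.shape _ _ (by simp), Limits.zero_comp]
  -- Truncated `0 - 1` is `0`, and there is no arrow `0 → 0` in the shape, so the incoming
  -- differential vanishes.
  have : IsIso (K.homologyπ 0) := K.isIso_homologyπ (0 - 1) 0 (by simp) (K.shape _ _ (by simp))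
  exact Limits.isZero_kernel_of_mono _

end HomologicalComplex

end BoundariesCycles

/-! ### Dévissage of Ext along a complex of injectives. -/

section Devissage

open Abelian HomologicalComplex

variable {R : Type u} [CommRing R] (S : ObjectProperty (ModuleCat.{u} R)) [S.IsSerreClass]
  (A : ModuleCat.{u} R)

/-- The middle term of the long exact sequence of `Ext(A, -)` belongs to a Serre class if its two
neighbours do. -/
theorem CategoryTheory.ObjectProperty.prop_ext_X₂_of_shortExact
    {T : ShortComplex (ModuleCat.{u} R)} (hT : T.ShortExact) (i : ℕ)
    (h₁ : S (ModuleCat.of R (Ext A T.X₁ i))) (h₃ : S (ModuleCat.of R (Ext A T.X₃ i))) :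
    S (ModuleCat.of R (Ext A T.X₂ i)) := by
  refine S.prop_of_function_exact ((Ext.mk₀ T.f).postcompOfLinear R A (add_zero i))
    ((Ext.mk₀ T.g).postcompOfLinear R A (add_zero i)) (fun x => ⟨fun hx => ?_, ?_⟩) h₁ h₃
  · exact Ext.covariant_sequence_exact₂ A hT x hx
  · rintro ⟨y, rfl⟩
    change (y.comp (Ext.mk₀ T.f) (add_zero i)).comp (Ext.mk₀ T.g) (add_zero i) = 0
    simp

variable (K : CochainComplex (ModuleCat.{u} R) ℕ)

theorem prop_ext_cycles (k i : ℕ) (h : S (ModuleCat.of R (Ext A (boundaries K k) i)))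
    (hH : S (ModuleCat.of R (Ext A (K.homology k) i))) :
    S (ModuleCat.of R (Ext A (K.cycles k) i)) :=
  S.prop_ext_X₂_of_shortExact A (shortExact_boundariesCyclesHomology K k) i h hH

variable [∀ k, Injective (K.X k)]

/-- For a complex `K` of injective modules, the modules `Extⁱ(A, Bᵏ)` with `i > 0` belong to a
Serre class as soon as `Extⁱ⁺ᵏ⁻ʲ(A, Hʲ(K))` does for all `j < k`. -/
theorem prop_ext_boundaries (k i : ℕ)
    (h : ∀ j < k, S (ModuleCat.of R (Ext A (K.homology j) (i + 1 + k - j)))) :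
    S (ModuleCat.of R (Ext A (boundaries K k) (i + 1))) := by
  induction k generalizing i with
  | zero =>
    have : Subsingleton (Ext A (boundaries K 0) (i + 1)) := ⟨fun x y => by
      rw [← x.comp_mk₀_id, ← y.comp_mk₀_id, (isZero_boundaries_zero K).eq_of_src (𝟙 _) 0,
        Ext.mk₀_zero, Ext.comp_zero, Ext.comp_zero]⟩
    exact S.prop_of_isZero (ModuleCat.isZero_of_subsingleton _)
  | succ k ih =>
    have hZ : S (ModuleCat.of R (Ext A (K.cycles k) (i + 1 + 1))) := by
      -- Lowering `k` raises `i`: the sum `i + k` is unchanged, so the hypotheses for `j < k` carry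
      -- over and `j = k` supplies the homology term.
      refine prop_ext_cycles S A K k _ (ih (i + 1) fun j hj => ?_) ?_
      · have := h j (hj.trans k.lt_succ_self)
        rwa [show i + 1 + (k + 1) - j = i + 1 + 1 + k - j by lia] at this
      · have := h k k.lt_succ_self
        rwa [show i + 1 + (k + 1) - k = i + 1 + 1 by lia] at this
    have hT := shortExact_cyclesBoundaries K k
    -- The kernel of the connecting map comes from `Extⁱ⁺¹(A, Kᵏ)`, zero because the degree is
    -- positive.
    refine S.prop_of_linearMap_injective (hT.extClass.postcompOfLinear R A rfl)
      ((injective_iff_map_eq_zero _).2 fun x hx => ?_) hZ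
    obtain ⟨y, rfl⟩ := Ext.covariant_sequence_exact₃ A hT x rfl hx
    have hy : y = 0 := Ext.eq_zero_of_injective (I := K.X k) y
    rw [hy, Ext.zero_comp]

end Devissage

/-! ### Kernel and cokernel of the natural map. -/

section Main

namespace LocalCohomologyViaTorsion

open Abelian HomologicalComplex

variable {R : Type u} [CommRing R] (𝔞 : Ideal R) {M : ModuleCat.{u} R}
  (I : InjectiveResolution M) (n : ℕ)

instance [IsNoetherianRing R] (k : ℕ) : Injective ((torsionComplex 𝔞 I).X k) :=
  inferInstanceAs (Injective ((torsionFunctor 𝔞).obj (I.cocomplex.X k)))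

/-- The linear map `Hom(R/𝔞, Hⁿ_𝔞(M)) → Ext¹(R/𝔞, Bⁿ)`. -/
noncomputable def homToExtBoundaries : (cyc 𝔞 ⟶ localCoh 𝔞 n M) →ₗ[R]
    Ext (cyc 𝔞) (boundaries (torsionComplex 𝔞 I) n) 1 :=
  (shortExact_boundariesCyclesHomology (torsionComplex 𝔞 I) n).extClass.postcompOfLinear R (cyc 𝔞)
      (zero_add 1) ∘ₗ
    (Ext.linearEquiv₀ (R := R)).symm.toLinearMap ∘ₗ
    Linear.rightComp R (cyc 𝔞) (localCohIso 𝔞 I n).inv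

/-- A map with zero connecting class lifts to `R/𝔞 → Zⁿ`; included into `Iⁿ`, the lift is a cocycle
whose Ext class is a preimage. -/
theorem ker_homToExtBoundaries_le :
    LinearMap.ker (homToExtBoundaries 𝔞 I n) ≤ LinearMap.range (naturalMapOf 𝔞 I n) := by
  intro η hη
  obtain ⟨y, hy⟩ := Ext.covariant_sequence_exact₃ (cyc 𝔞)
    (shortExact_boundariesCyclesHomology (torsionComplex 𝔞 I) n)
    (Ext.mk₀ (η ≫ (localCohIso 𝔞 I n).inv)) (zero_add 1) hη
  obtain ⟨ζ, rfl⟩ := Ext.mk₀_bijective _ _ |>.2 y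
  rw [Ext.mk₀_comp_mk₀] at hy
  replace hy : ζ ≫ (torsionComplex 𝔞 I).homologyπ n = η ≫ (localCohIso 𝔞 I n).inv :=
    (Ext.mk₀_bijective _ _).1 hy
  let θ : cyc 𝔞 ⟶ (torsionFunctor 𝔞).obj (I.cocomplex.X n) :=
    ζ ≫ (torsionComplex 𝔞 I).iCycles n
  have hθ : θ ≫ (torsionFunctor 𝔞).map (I.cocomplex.d n (n + 1)) = 0 := by
    refine (Category.assoc _ _ _).trans ?_
    exact (congrArg (ζ ≫ ·) ((torsionComplex 𝔞 I).iCycles_d n (n + 1))).trans Limits.comp_zero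
  have hφ : (θ ≫ torsionIncl 𝔞 _) ≫ I.cocomplex.d n (n + 1) = 0 :=
    congrArg (fun ψ => ψ ≫ torsionIncl 𝔞 (I.cocomplex.X (n + 1))) hθ
  refine ⟨cocyclesToExt 𝔞 I n ⟨θ ≫ torsionIncl 𝔞 _, hφ⟩, ?_⟩
  rw [naturalMapOf_cocyclesToExt]
  have hζ : toTorsionCycles 𝔞 I _ hφ = ζ := by
    rw [← cancel_mono ((torsionComplex 𝔞 I).iCycles n), toTorsionCycles_i]
    rfl
  change toTorsionCycles 𝔞 I _ hφ ≫ (torsionComplex 𝔞 I).homologyπ n ≫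
    (localCohIso 𝔞 I n).hom = η
  rw [hζ, reassoc_of% hy, Iso.inv_hom_id, Category.comp_id]

variable {𝔞 I n} in
theorem toTorsionCycles_homologyπ_eq_zero {φ : cocycles 𝔞 I n}
    (h : φ ∈ LinearMap.ker (cocyclesToHom 𝔞 I n)) :
    toTorsionCycles 𝔞 I φ.1 (mem_cocycles 𝔞 I φ.2) ≫ (torsionComplex 𝔞 I).homologyπ n = 0 := by
  rw [← cancel_mono (localCohIso 𝔞 I n).hom, Category.assoc, Limits.zero_comp]
  exact h

variable {𝔞 I n} in
/-- A cocycle killed by `cocyclesToHom`, as a homomorphism to the boundaries. -/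
noncomputable def liftBoundaries (φ : LinearMap.ker (cocyclesToHom 𝔞 I n)) :
    cyc 𝔞 ⟶ boundaries (torsionComplex 𝔞 I) n :=
  Limits.kernel.lift _ _ (toTorsionCycles_homologyπ_eq_zero φ.2)

variable {𝔞 I n} in
theorem liftBoundaries_ι_iCycles (φ : LinearMap.ker (cocyclesToHom 𝔞 I n)) :
    liftBoundaries φ ≫ Limits.kernel.ι _ ≫ (torsionComplex 𝔞 I).iCycles n =
      toTorsion 𝔞 φ.1.1 := by
  rw [liftBoundaries, Limits.kernel.lift_ι_assoc]
  exact toTorsionCycles_i 𝔞 I φ.1.1 _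

/-- The linear map `liftBoundaries`. -/
noncomputable def kerToBoundaries :
    LinearMap.ker (cocyclesToHom 𝔞 I n) →ₗ[R]
      (cyc 𝔞 ⟶ boundaries (torsionComplex 𝔞 I) n) where
  toFun φ := liftBoundaries φ
  map_add' φ ψ := by
    rw [← cancel_mono (Limits.kernel.ι _ ≫ (torsionComplex 𝔞 I).iCycles n),
      Preadditive.add_comp, liftBoundaries_ι_iCycles, liftBoundaries_ι_iCycles,
      liftBoundaries_ι_iCycles]
    rfl
  map_smul' r φ := by
    rw [← cancel_mono (Limits.kernel.ι _ ≫ (torsionComplex 𝔞 I).iCycles n),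
      RingHom.id_apply, Linear.smul_comp, liftBoundaries_ι_iCycles, liftBoundaries_ι_iCycles]
    rfl

/-- The linear map from the cocycles of degree `n + 1` which are killed by `cocyclesToHom` to
`Ext¹(R/𝔞, Zⁿ)`. -/
noncomputable def kerToExtCycles : LinearMap.ker (cocyclesToHom 𝔞 I (n + 1)) →ₗ[R]
    Ext (cyc 𝔞) ((torsionComplex 𝔞 I).cycles n) 1 :=
  (shortExact_cyclesBoundaries (torsionComplex 𝔞 I) n).extClass.postcompOfLinear R (cyc 𝔞)
      (zero_add 1) ∘ₗ
    (Ext.linearEquiv₀ (R := R)).symm.toLinearMap ∘ₗ kerToBoundaries 𝔞 I (n + 1)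

/-- The restriction of `cocyclesToExt` to the kernels of the maps to `Hom(R/𝔞, Hⁿ_𝔞(M))`. -/
noncomputable def kerToKer :
    LinearMap.ker (cocyclesToHom 𝔞 I n) →ₗ[R] LinearMap.ker (naturalMapOf 𝔞 I n) :=
  (cocyclesToExt 𝔞 I n).restrict fun φ hφ => by
    rw [LinearMap.mem_ker, naturalMapOf_cocyclesToExt]
    exact hφ

theorem kerToKer_surjective : Function.Surjective (kerToKer 𝔞 I n) := by
  rintro ⟨x, hx⟩
  obtain ⟨φ, rfl⟩ := cocyclesToExt_surjective 𝔞 I n x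
  rw [LinearMap.mem_ker, naturalMapOf_cocyclesToExt] at hx
  exact ⟨⟨φ, hx⟩, rfl⟩

/-- If the connecting class vanishes, `R/𝔞 → Bⁿ⁺¹` lifts to `Γ_𝔞(Iⁿ)`, which exhibits the cocycle as
a coboundary in `Hom(R/𝔞, I)`. -/
theorem ker_kerToExtCycles_le :
    LinearMap.ker (kerToExtCycles 𝔞 I n) ≤ LinearMap.ker (kerToKer 𝔞 I (n + 1)) := by
  intro φ hφ
  obtain ⟨y, hy⟩ := Ext.covariant_sequence_exact₃ (cyc 𝔞)
    (shortExact_cyclesBoundaries (torsionComplex 𝔞 I) n)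
    (Ext.mk₀ (liftBoundaries φ)) (zero_add 1) hφ
  obtain ⟨ψ, rfl⟩ := Ext.mk₀_bijective _ _ |>.2 y
  rw [Ext.mk₀_comp_mk₀] at hy
  replace hy : ψ ≫ toBoundaries (torsionComplex 𝔞 I) n = liftBoundaries φ :=
    (Ext.mk₀_bijective _ _).1 hy
  have hd : ψ ≫ (torsionFunctor 𝔞).map (I.cocomplex.d n (n + 1)) = toTorsion 𝔞 φ.1.1 := by
    rw [← liftBoundaries_ι_iCycles, ← hy, Category.assoc, toBoundaries_ι_iCycles]
    rfl
  have hd' : (ψ ≫ torsionIncl 𝔞 (I.cocomplex.X n)) ≫ I.cocomplex.d n (n + 1) = φ.1.1 :=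
    congrArg (fun χ => χ ≫ torsionIncl 𝔞 (I.cocomplex.X (n + 1))) hd
  exact Subtype.ext ((I.extMk_eq_zero_iff φ.1.1 (n + 1 + 1) rfl φ.1.2 n rfl).2 ⟨_, hd'⟩)

/-- There is no `Z⁻¹` to embed into; instead `B⁰ = 0` forces every cocycle in the kernel to vanish.
-/
theorem ker_naturalMapOf_zero : LinearMap.ker (naturalMapOf 𝔞 I 0) = ⊥ := by
  refine (Submodule.eq_bot_iff _).2 fun x hx => ?_
  obtain ⟨φ, hφ⟩ := kerToKer_surjective 𝔞 I 0 ⟨x, hx⟩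
  have hφ0 : φ = 0 := by
    refine Subtype.ext (Subtype.ext ?_)
    have h := liftBoundaries_ι_iCycles φ
    rw [(isZero_boundaries_zero (torsionComplex 𝔞 I)).eq_of_tgt (liftBoundaries φ) 0,
      Limits.zero_comp] at h
    exact congrArg (fun χ => χ ≫ torsionIncl 𝔞 (I.cocomplex.X 0)) h.symm
  rw [hφ0, map_zero] at hφ
  exact (congrArg Subtype.val hφ).symm

variable (S : ObjectProperty (ModuleCat.{u} R)) [S.IsSerreClass]

/-- Moves the hypotheses from the derived functor to the complex `Γ_𝔞(I)`, where the dévissage runs.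
-/
theorem prop_ext_homology {j i : ℕ} (h : S (extCyc 𝔞 i (localCoh 𝔞 j M))) :
    S (ModuleCat.of R (Ext (cyc 𝔞) ((torsionComplex 𝔞 I).homology j) i)) := by
  refine S.prop_of_linearMap_injective
    ((Ext.mk₀ (localCohIso 𝔞 I j).hom).postcompOfLinear R (cyc 𝔞) (add_zero i))
    (Function.LeftInverse.injective
      (g := fun x => x.comp (Ext.mk₀ (localCohIso 𝔞 I j).inv) (add_zero i)) fun x => ?_) h
  change (x.comp (Ext.mk₀ (localCohIso 𝔞 I j).hom) (add_zero i)).comp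
    (Ext.mk₀ (localCohIso 𝔞 I j).inv) (add_zero i) = x
  simp

variable [IsNoetherianRing R]

theorem prop_ker_naturalMapOf (h : ∀ j < n, S (extCyc 𝔞 (n - j) (localCoh 𝔞 j M))) :
    S (ModuleCat.of R (LinearMap.ker (naturalMapOf 𝔞 I n))) := by
  rcases n with _ | n
  · rw [ker_naturalMapOf_zero]
    exact S.prop_of_isZero (ModuleCat.isZero_of_subsingleton _)
  -- Here `n` is the predecessor of the original degree. `Ext¹(R/𝔞, Zⁿ)` is bounded by `Ext¹(R/𝔞,
  -- Bⁿ)`, which uses `j < n`, and `Ext¹(R/𝔞, Hⁿ)`, which is the case `j = n`.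
  · refine S.prop_of_ker_le_ker (kerToKer 𝔞 I (n + 1)) (kerToKer_surjective 𝔞 I (n + 1))
      (kerToExtCycles 𝔞 I n) (ker_kerToExtCycles_le 𝔞 I n)
      (prop_ext_cycles S _ _ n 1 (prop_ext_boundaries S _ _ n 0 fun j hj => ?_) ?_)
    · have := h j (hj.trans n.lt_succ_self)
      rw [show n + 1 - j = 0 + 1 + n - j by lia] at this
      exact prop_ext_homology 𝔞 I S this
    · have := h n n.lt_succ_self
      rw [Nat.add_sub_cancel_left] at this
      exact prop_ext_homology 𝔞 I S this

theorem prop_coker_naturalMapOf (h : ∀ j < n, S (extCyc 𝔞 (n + 1 - j) (localCoh 𝔞 j M))) :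
    S (ModuleCat.of R (homCyc 𝔞 (localCoh 𝔞 n M) ⧸ LinearMap.range (naturalMapOf 𝔞 I n))) := by
  refine S.prop_of_ker_le_ker (LinearMap.range (naturalMapOf 𝔞 I n)).mkQ
    (Submodule.mkQ_surjective _) (homToExtBoundaries 𝔞 I n)
    ((ker_homToExtBoundaries_le 𝔞 I n).trans (Submodule.ker_mkQ _).ge)
    (prop_ext_boundaries S _ _ n 0 fun j hj => ?_)
  have := h j hj
  rw [show n + 1 - j = 0 + 1 + n - j by lia] at this
  exact prop_ext_homology 𝔞 I S this

theorem serreClass_naturalMap (M : ModuleCat.{u} R) :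
    ((∀ j < n, S (extCyc 𝔞 (n - j) (localCoh 𝔞 j M))) → S (kerNaturalMap 𝔞 M n)) ∧
    ((∀ j < n, S (extCyc 𝔞 (n + 1 - j) (localCoh 𝔞 j M))) → S (cokerNaturalMap 𝔞 M n)) ∧
    ((∀ t ∈ ({n, n + 1} : Set ℕ), ∀ j < n, S (extCyc 𝔞 (t - j) (localCoh 𝔞 j M))) →
      S (kerNaturalMap 𝔞 M n) ∧ S (cokerNaturalMap 𝔞 M n) ∧
      (S (extCyc 𝔞 n M) ↔ S (homCyc 𝔞 (localCoh 𝔞 n M)))) := by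
  refine ⟨prop_ker_naturalMapOf 𝔞 _ n S, prop_coker_naturalMapOf 𝔞 _ n S, fun h => ?_⟩
  have hker := prop_ker_naturalMapOf 𝔞 (injectiveResolution M) n S (h n (by simp))
  have hcoker := prop_coker_naturalMapOf 𝔞 (injectiveResolution M) n S (h (n + 1) (by simp))
  refine ⟨hker, hcoker, fun hE => ?_, fun hH => ?_⟩
  · exact S.prop_of_function_exact (naturalMap 𝔞 M n) (LinearMap.range (naturalMap 𝔞 M n)).mkQ
      (LinearMap.exact_map_mkQ_range _) hE hcoker
  · exact S.prop_of_function_exact (LinearMap.ker (naturalMap 𝔞 M n)).subtype (naturalMap 𝔞 M n)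
      (LinearMap.exact_subtype_ker_map _) hker hH

end LocalCohomologyViaTorsion

end Main

open LocalCohomologyViaTorsion in
theorem proposition2p1 {R : Type u} [CommRing R] [IsNoetherianRing R] (𝔞 : Ideal R)
    (M : ModuleCat.{u} R) (n : ℕ) :
    (∀ (S : ObjectProperty (ModuleCat.{u} R)), S.IsSerreClass →
      ((∀ j < n, S (extCyc 𝔞 (n - j) (localCoh 𝔞 j M))) → S (kerNaturalMap 𝔞 M n)) ∧
      ((∀ j < n, S (extCyc 𝔞 (n + 1 - j) (localCoh 𝔞 j M))) → S (cokerNaturalMap 𝔞 M n)) ∧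
      ((∀ t ∈ ({n, n + 1} : Set ℕ), ∀ j < n, S (extCyc 𝔞 (t - j) (localCoh 𝔞 j M))) →
        S (kerNaturalMap 𝔞 M n) ∧ S (cokerNaturalMap 𝔞 M n) ∧
        (S (extCyc 𝔞 n M) ↔ S (homCyc 𝔞 (localCoh 𝔞 n M))))) ∧
    ((∀ j < n, Module.Finite R (extCyc 𝔞 (n - j) (localCoh 𝔞 j M))) →
      Module.Finite R (kerNaturalMap 𝔞 M n)) ∧
    ((∀ j < n, Module.Finite R (extCyc 𝔞 (n + 1 - j) (localCoh 𝔞 j M))) →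
      Module.Finite R (cokerNaturalMap 𝔞 M n)) ∧
    ((∀ t ∈ ({n, n + 1} : Set ℕ), ∀ j < n,
        Module.Finite R (extCyc 𝔞 (t - j) (localCoh 𝔞 j M))) →
      Module.Finite R (kerNaturalMap 𝔞 M n) ∧ Module.Finite R (cokerNaturalMap 𝔞 M n) ∧
      (Module.Finite R (extCyc 𝔞 n M) ↔ Module.Finite R (homCyc 𝔞 (localCoh 𝔞 n M)))) := by
  have := ModuleCat.isSerreClass_finite (R := R)
  exact ⟨fun S _ => serreClass_naturalMap 𝔞 n S M,
    serreClass_naturalMap 𝔞 n (fun X : ModuleCat.{u} R => Module.Finite R X) M⟩
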